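/- Let $P_Y$ be a probability distribution on $\{0,1\}$ with $P_Y(0),P_Y(1)>0$. There is a constant $c>0$, depending only on $P_Y$, such that the following holds. Let $\mathcal X$ be a finite set, $P_{0,X}$ a probability distribution on $\mathcal X$ with $P_{0,X}(x)>0$ for all $x$, and for $\epsilon>0$ let $$\mathcal N_\epsilon(P_{0,X})=\Big\{P \text{ a probability distribution on }\mathcal X:\ \sum_{x\in\mathcal X}\frac{(P(x)-P_{0,X}(x))^2}{P_{0,X}(x)}\le\epsilon^2\Big\}.$$ For every $\delta>0$ there is $\epsilon_0>0$ such that for all $0<\epsilon<\epsilon_0$, all $P_{X|Y=0},P_{X|Y=1}\in\mathcal N_\epsilon(P_{0,X})$, all $k\ge 0$ and all features $f:\mathcal X\to\mathbb R^k$ with $\mathbb E[f(X)]=0$ and $\mathbb E[f(X)f(X)^{\mathrm T}]=I$ (expectations under $P_X=\sum_y P_Y(y)P_{X|Y=y}$), the error exponent $E_f^k$ exists and $$\big|E_f^k-c\,\mathcal H(f)\big|\le\delta\,\epsilon^2,\qquad \mathcal H(f)=\mathrm{tr}\big(\mathrm{cov}(f(X))^{-1}\,\mathrm{cov}(\mathbb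 E[f(X)|Y])\big)=\mathrm{tr}\big(\mathrm{cov}(\mathbb E[f(X)|Y])\big).$$ That is, $E_f^k=c\,\mathcal H(f)+o(\epsilon^2)$, uniformly in $f$, $k$ and the class-conditional distributions. Here $E_f^k$ is the best achievable exponent of the Bayesian error probability in testing $P_{X|Y=0}$ against $P_{X|Y=1}$ from the statistic $l^k=\frac1m\sum_{j=1}^m f(x^{(j)})$ of $m$ i.i.d. samples. For a closed decision region $A\subseteq\mathbb R^k$ (not depending on $m$) put $$P_e^{(m)}(A)=P_Y(0)\,P_{X|Y=0}^{m}(l^k\notin A)+P_Y(1)\,P_{X|Y=1}^{m}(l^k\in A);$$ then $E_f^k$ is the common value of $\sup_A\liminf_{m\to\infty}-\frac1m\log P_e^{(m)}(A)$ and $\sup_A\limsup_{m\to\infty}-\frac1m\log P_e^{(m)}(A)$, and its existence means that these two are equal and finite. The logarithm is natural. -/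

import Mathlib

open Filter

noncomputable section

namespace HScore

/-- The `ε`-neighborhood of the reference distribution `P₀` on a finite alphabet: the probability
distributions `P` with `∑ x, (P x - P₀ x)² / P₀ x ≤ ε²`. -/
def chiSqBall {X : Type*} [Fintype X] (P₀ : X → ℝ) (ε : ℝ) : Set (X → ℝ) :=
  {P | P ∈ stdSimplex ℝ X ∧ ∑ x, (P x - P₀ x) ^ 2 / P₀ x ≤ ε ^ 2}

/-- Expectation `E[g]` of a vector-valued function under a finitely supported distribution. -/
def mean {Ω : Type*} [Fintype Ω] {k : ℕ} (P : Ω → ℝ) (g : Ω → Fin k → ℝ) : Fin k → ℝ :=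
  ∑ ω, P ω • g ω

/-- The second moment matrix `E[g gᵀ]`. -/
def secondMoment {Ω : Type*} [Fintype Ω] {k : ℕ} (P : Ω → ℝ) (g : Ω → Fin k → ℝ) :
    Matrix (Fin k) (Fin k) ℝ :=
  ∑ ω, P ω • Matrix.vecMulVec (g ω) (g ω)

/-- The covariance matrix `cov(g) = E[(g - E g)(g - E g)ᵀ]`. -/
def cov {Ω : Type*} [Fintype Ω] {k : ℕ} (P : Ω → ℝ) (g : Ω → Fin k → ℝ) :
    Matrix (Fin k) (Fin k) ℝ :=
  secondMoment P (fun ω => g ω - mean P g)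

/-- The marginal law `P_X` of the pair `(X, Y)` with `Y ∼ pY` and `P_{X|Y=y} = W y`. -/
def marginal {X : Type*} (pY : Fin 2 → ℝ) (W : Fin 2 → X → ℝ) : X → ℝ :=
  fun x => ∑ y, pY y * W y x

/-- The conditional expectation `y ↦ E[f(X) | Y = y]`. -/
def condMean {X : Type*} [Fintype X] {k : ℕ} (W : Fin 2 → X → ℝ) (f : X → Fin k → ℝ) :
    Fin 2 → Fin k → ℝ :=
  fun y => mean (W y) f

/-- The H-score `tr(cov(f(X))⁻¹ cov(E[f(X)|Y]))`. It is `tr(cov(E[f(X)|Y]))` for a feature with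
`cov(f(X)) = I`. -/
def hScore {X : Type*} [Fintype X] {k : ℕ} (pY : Fin 2 → ℝ) (W : Fin 2 → X → ℝ)
    (f : X → Fin k → ℝ) : ℝ :=
  ((cov (marginal pY W) f)⁻¹ * cov pY (condMean W f)).trace

/-- The probability of the event `S` for `m` i.i.d. observations with law `P`. -/
def iidProb {X : Type*} [Fintype X] (P : X → ℝ) (m : ℕ) (S : Set (Fin m → X)) : ℝ :=
  ∑ x : Fin m → X, S.indicator (fun x => ∏ i, P (x i)) x

/-- The statistic `(1/m) ∑ f(x⁽ⁱ⁾)`, the empirical mean of the feature over the sample. -/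
def empMean {X : Type*} {k m : ℕ} (f : X → Fin k → ℝ) (x : Fin m → X) : Fin k → ℝ :=
  (m : ℝ)⁻¹ • ∑ i, f (x i)

/-- The Bayesian error probability, with prior `pY`, of the test on `m` i.i.d. samples that decides
for class `0` when the empirical mean of `f` lies in `A` and for class `1` otherwise. -/
def bayesError {X : Type*} [Fintype X] {k : ℕ} (pY : Fin 2 → ℝ) (W : Fin 2 → X → ℝ)
    (f : X → Fin k → ℝ) (A : Set (Fin k → ℝ)) (m : ℕ) : ℝ :=
  pY 0 * iidProb (W 0) m {x | empMean f x ∉ A} + pY 1 * iidProb (W 1) m {x | empMean f x ∈ A}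

/-- `E` is the best exponent of the Bayesian error probability among the tests based on the
empirical mean of `f`, with a closed decision region `A` in the space of values of the statistic:
every rate `r < E` is achieved by some test, and no test achieves a rate `r > E`, even along a
subsequence of sample sizes. With `e A m = -(1/m) log (bayesError pY W f A m)` this says that
`E` is both the supremum over `A` of `liminf e A` and the supremum over `A` of `limsup e A`;
there is at most one such `E`. -/
def IsErrorExponent {X : Type*} [Fintype X] {k : ℕ} (pY : Fin 2 → ℝ) (W : Fin 2 → X → ℝ)
    (f : X → Fin k → ℝ) (E : ℝ) : Prop :=
  (∀ r < E, ∃ A : Set (Fin k → ℝ), IsClosed A ∧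
    ∀ᶠ m : ℕ in atTop, bayesError pY W f A m ≤ Real.exp (-(m * r))) ∧
  (∀ r > E, ∀ A : Set (Fin k → ℝ), IsClosed A →
    ∀ᶠ m : ℕ in atTop, Real.exp (-(m * r)) < bayesError pY W f A m)

end HScore

end

/-! By the method of types, a test that only sees the mean of `f` confuses the classes at the cost
of finding `Q₀`, `Q₁` with equal feature means. The exponent is therefore the infimum of `max (D(Q₀
‖ W 0)) (D(Q₁ ‖ W 1))` over such pairs (`isErrorExponent_sInf`). A test attaining it decides for
class 0 on the means of a divergence ball around `W 0`.

Near `P₀` the divergence is half a chi-square distance up to a factor `1 + O(κ)`. In that quadratic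
geometry a normalized feature is orthonormal, so moving the mean by `v` costs about `|v|² / 2`. With
`2v` the difference of the class means, the best pair meets at the midpoint, and the exponent is
`|v|² / 2` up to a relative error of order `κ` (`abs_sInf_exponentSet_sub_le`). The H-score is
exactly `4 pY(0) pY(1) |v|²` (`hScore_eq`), which fixes `c`.

Uniformity in `k` and `f` comes from a Bessel inequality (`four_mul_dotProduct_self_le`): `|v|² ≤
2ε²`. Normalization then makes `⟨f x, v⟩` uniformly small, even though `f` itself has no
dimension-free bound here. -/

namespace HScore

open scoped Topology

variable {X : Type*} [Fintype X]

/-! ### Relative entropy on a finite alphabet -/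

/-- The relative entropy `D(Q ‖ W)` on a finite alphabet, for `W` of full support. -/
noncomputable def relEntropy (Q W : X → ℝ) : ℝ :=
  ∑ x, Q x * (Real.log (Q x) - Real.log (W x))

/-- The empirical distribution of a sample. -/
noncomputable def empDist {α : Type*} {m : ℕ} (x : Fin m → α) : α → ℝ :=
  open Classical in fun a => (m : ℝ)⁻¹ * ∑ i, if x i = a then 1 else 0

theorem continuous_relEntropy (W : X → ℝ) : Continuous fun Q : X → ℝ => relEntropy Q W := by
  have h : (fun Q : X → ℝ => relEntropy Q W)
      = fun Q => ∑ x, (Q x * Real.log (Q x) - Q x * Real.log (W x)) := by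
    funext Q; simp only [relEntropy, mul_sub]
  rw [h]
  refine continuous_finsetSum _ fun x _ => ?_
  exact (Real.continuous_mul_log.comp (continuous_apply x)).sub
    ((continuous_apply x).mul continuous_const)

theorem continuous_mean {k : ℕ} (f : X → Fin k → ℝ) : Continuous fun Q : X → ℝ => mean Q f := by
  unfold mean; fun_prop

/-- This is `log t ≤ t - 1` at `t = w e^g / q`. The case `q = 0` is separate. -/
theorem mul_log_sub_log_ge {q w : ℝ} (hq : 0 ≤ q) (hw : 0 < w) (g : ℝ) :
    q * g - w * Real.exp g + q ≤ q * (Real.log q - Real.log w) := by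
  rcases hq.eq_or_lt with rfl | hq
  · simpa using (mul_pos hw (Real.exp_pos g)).le
  · have h := Real.log_le_sub_one_of_pos (div_pos (mul_pos hw (Real.exp_pos g)) hq)
    rw [Real.log_div (by positivity) hq.ne', Real.log_mul hw.ne' (Real.exp_pos g).ne',
      Real.log_exp] at h
    have := mul_le_mul_of_nonneg_left h hq.le
    have e : q * (w * Real.exp g / q - 1) = w * Real.exp g - q := by field_simp
    rw [e] at this
    linarith

/-- The variational lower bound for the relative entropy. -/
theorem relEntropy_ge {Q W : X → ℝ} (hQ : Q ∈ stdSimplex ℝ X) (hW : ∀ x, 0 < W x) (g : X → ℝ) :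
    ∑ x, Q x * g x - ∑ x, W x * Real.exp (g x) + 1 ≤ relEntropy Q W := by
  rw [← hQ.2, ← Finset.sum_sub_distrib, ← Finset.sum_add_distrib]
  exact Finset.sum_le_sum fun x _ => mul_log_sub_log_ge (hQ.1 x) (hW x) (g x)

theorem relEntropy_nonneg {Q W : X → ℝ} (hQ : Q ∈ stdSimplex ℝ X) (hW : W ∈ stdSimplex ℝ X)
    (hWpos : ∀ x, 0 < W x) : 0 ≤ relEntropy Q W := by
  simpa [hW.2] using relEntropy_ge hQ hWpos 0

theorem relEntropy_pos {Q W : X → ℝ} (hQ : Q ∈ stdSimplex ℝ X) (hW : W ∈ stdSimplex ℝ X)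
    (hWpos : ∀ x, 0 < W x) (hne : Q ≠ W) : 0 < relEntropy Q W := by
  obtain ⟨a, ha⟩ := Function.ne_iff.1 hne
  have key : ∑ x, (Q x - W x) < relEntropy Q W := by
    refine Finset.sum_lt_sum (fun x _ => ?_) ⟨a, Finset.mem_univ a, ?_⟩
    · have := mul_log_sub_log_ge (hQ.1 x) (hWpos x) 0
      simp only [Real.exp_zero] at this
      linarith
    · rcases (hQ.1 a).eq_or_lt with h0 | h0
      · rw [← h0]; simpa using hWpos a
      · have h := Real.log_lt_sub_one_of_pos (div_pos (hWpos a) h0)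
          (fun h => ha ((div_eq_one_iff_eq h0.ne').1 h).symm)
        rw [Real.log_div (hWpos a).ne' h0.ne'] at h
        have := mul_lt_mul_of_pos_left h h0
        have e : Q a * (W a / Q a - 1) = W a - Q a := by field_simp
        rw [e] at this
        linarith
  rw [Finset.sum_sub_distrib, hQ.2, hW.2, sub_self] at key
  exact key

/-! ### Empirical distributions and the method of types -/

theorem sum_empDist_mul {m : ℕ} (x : Fin m → X) (h : X → ℝ) :
    ∑ a, empDist x a * h a = (m : ℝ)⁻¹ * ∑ i, h (x i) := by
  classical
  simp only [empDist, mul_assoc, ← Finset.mul_sum, Finset.sum_mul]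
  rw [Finset.sum_comm]
  simp

theorem empDist_mem_stdSimplex {m : ℕ} (hm : 0 < m) (x : Fin m → X) :
    empDist x ∈ stdSimplex ℝ X := by
  refine ⟨fun a => ?_, ?_⟩
  · unfold empDist
    exact mul_nonneg (by positivity) (Finset.sum_nonneg fun i _ => by split_ifs <;> simp)
  · have := sum_empDist_mul x fun _ => 1
    simp only [mul_one, Finset.sum_const, Finset.card_univ, Fintype.card_fin, nsmul_eq_mul] at this
    rw [this, inv_mul_cancel₀ (by positivity)]

theorem empDist_apply_pos {α : Type*} {m : ℕ} (hm : 0 < m) (x : Fin m → α) (i : Fin m) :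
    0 < empDist x (x i) := by
  classical
  unfold empDist
  refine mul_pos (by positivity) (Finset.sum_pos' (fun j _ => by split_ifs <;> simp)
    ⟨i, Finset.mem_univ i, by simp⟩)

theorem mean_empDist {k m : ℕ} (f : X → Fin k → ℝ) (x : Fin m → X) :
    mean (empDist x) f = empMean f x := by
  funext j
  have := sum_empDist_mul x fun a => f a j
  simpa [mean, empMean, Finset.sum_apply] using this

/-- Change of measure: the likelihood ratio depends on the sample only through its type. Positivity
is asked only at sample points, so that `Q` may be the type itself. -/
theorem prod_eq_exp_mul_prod {m : ℕ} (hm : 0 < m) (x : Fin m → X) {Q W : X → ℝ}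
    (hQ : ∀ i, 0 < Q (x i)) (hW : ∀ i, 0 < W (x i)) :
    ∏ i, W (x i) =
      Real.exp (-(m * ∑ a, empDist x a * (Real.log (Q a) - Real.log (W a)))) * ∏ i, Q (x i) := by
  have hexp : ∀ {V : X → ℝ}, (∀ i, 0 < V (x i)) →
      ∏ i, V (x i) = Real.exp (∑ i, Real.log (V (x i))) := fun {V} hV => by
    rw [Real.exp_sum]
    exact Finset.prod_congr rfl fun i _ => (Real.exp_log (hV i)).symm
  rw [hexp hQ, hexp hW, ← Real.exp_add, sum_empDist_mul x fun a => Real.log (Q a) - Real.log (W a),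
    mul_inv_cancel_left₀ (by positivity), Finset.sum_sub_distrib]
  congr 1
  ring

theorem sum_prod_eq_one {Q : X → ℝ} (hQ : Q ∈ stdSimplex ℝ X) (m : ℕ) :
    ∑ x : Fin m → X, ∏ i, Q (x i) = 1 := by
  rw [← Fintype.sum_pow, hQ.2, one_pow]

theorem iidProb_mono {W : X → ℝ} (hW : ∀ x, 0 ≤ W x) {m : ℕ} {S T : Set (Fin m → X)}
    (h : S ⊆ T) : iidProb W m S ≤ iidProb W m T :=
  Finset.sum_le_sum fun x _ => Set.indicator_le_indicator_of_subset h
    (fun _ => Finset.prod_nonneg fun _ _ => hW _) x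

theorem iidProb_nonneg {W : X → ℝ} (hW : ∀ x, 0 ≤ W x) (m : ℕ) (S : Set (Fin m → X)) :
    0 ≤ iidProb W m S :=
  Finset.sum_nonneg fun _ _ => Set.indicator_nonneg
    (fun _ _ => Finset.prod_nonneg fun _ _ => hW _) _

theorem iidProb_add_compl {W : X → ℝ} (hW : W ∈ stdSimplex ℝ X) (m : ℕ) (S : Set (Fin m → X)) :
    iidProb W m S + iidProb W m Sᶜ = 1 := by
  rw [iidProb, iidProb, ← Finset.sum_add_distrib, ← sum_prod_eq_one hW m]
  exact Finset.sum_congr rfl fun x _ => Set.indicator_self_add_compl_apply S _ x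

/-- Each product is dominated by the sum over all types `q`. Every `q` contributes total mass 1, and
there are at most `(m + 1) ^ |X|` types because their coordinates are multiples `c / m` with `0 ≤ c
≤ m`. -/
theorem sum_prod_empDist_le {m : ℕ} (hm : 0 < m) :
    ∑ x : Fin m → X, ∏ i, empDist x (x i) ≤ ((m : ℝ) + 1) ^ Fintype.card X := by
  classical
  set T : Finset (X → ℝ) := Finset.univ.image fun x : Fin m → X => empDist x with hT
  have hsimp : ∀ q ∈ T, q ∈ stdSimplex ℝ X := by
    intro q hq
    obtain ⟨x, -, rfl⟩ := Finset.mem_image.1 hq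
    exact empDist_mem_stdSimplex hm x
  have hcard : T.card ≤ (m + 1) ^ Fintype.card X := by
    have hsub : T ⊆ Finset.univ.image
        fun (c : X → Fin (m + 1)) (a : X) => (m : ℝ)⁻¹ * ((c a : ℕ) : ℝ) := by
      intro q hq
      obtain ⟨x, -, rfl⟩ := Finset.mem_image.1 hq
      refine Finset.mem_image.2 ⟨fun a => ⟨(Finset.univ.filter fun i => x i = a).card, ?_⟩,
        Finset.mem_univ _, ?_⟩
      · exact Nat.lt_succ_of_le ((Finset.card_le_univ _).trans (by simp))
      · funext a
        simp [empDist]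
    calc T.card ≤ _ := Finset.card_le_card hsub
      _ ≤ _ := Finset.card_image_le
      _ = (m + 1) ^ Fintype.card X := by simp
  calc ∑ x : Fin m → X, ∏ i, empDist x (x i)
      ≤ ∑ x : Fin m → X, ∑ q ∈ T, ∏ i, q (x i) := by
        refine Finset.sum_le_sum fun x _ => ?_
        exact Finset.single_le_sum (f := fun q : X → ℝ => ∏ i, q (x i))
          (fun q hq => Finset.prod_nonneg fun i _ => (hsimp q hq).1 _)
          (Finset.mem_image_of_mem _ (Finset.mem_univ x))
    _ = ∑ q ∈ T, ∑ x : Fin m → X, ∏ i, q (x i) := Finset.sum_comm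
    _ = T.card := by
        rw [Finset.sum_congr rfl fun q hq => sum_prod_eq_one (hsimp q hq) m]
        simp
    _ ≤ ((m : ℝ) + 1) ^ Fintype.card X := by exact_mod_cast hcard

/-- The method of types: an event all of whose empirical distributions have relative entropy at
least `r` from the law has probability at most `(m + 1) ^ |X| * exp (- m r)`. -/
theorem iidProb_le_of_le_relEntropy {W : X → ℝ} (hW : ∀ x, 0 < W x) {m : ℕ} (hm : 0 < m)
    {S : Set (Fin m → X)} {r : ℝ} (hS : ∀ x ∈ S, r ≤ relEntropy (empDist x) W) :
    iidProb W m S ≤ ((m : ℝ) + 1) ^ Fintype.card X * Real.exp (-(m * r)) := by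
  calc iidProb W m S ≤ ∑ x : Fin m → X, Real.exp (-(m * r)) * ∏ i, empDist x (x i) := by
        refine Finset.sum_le_sum fun x _ => ?_
        have hpos : 0 ≤ ∏ i, empDist x (x i) :=
          Finset.prod_nonneg fun i _ => (empDist_apply_pos hm x i).le
        by_cases hx : x ∈ S
        · rw [Set.indicator_of_mem hx,
            prod_eq_exp_mul_prod hm x (empDist_apply_pos hm x) fun i => hW (x i)]
          refine mul_le_mul_of_nonneg_right (Real.exp_le_exp.2 (neg_le_neg ?_)) hpos
          exact mul_le_mul_of_nonneg_left (hS x hx) (Nat.cast_nonneg m)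
        · rw [Set.indicator_of_notMem hx]
          exact mul_nonneg (Real.exp_pos _).le hpos
    _ ≤ _ := by
        rw [← Finset.mul_sum, mul_comm]
        exact mul_le_mul_of_nonneg_right (sum_prod_empDist_le hm) (Real.exp_pos _).le

/-! ### Law of large numbers and large deviations lower bound -/

theorem tendsto_succ_pow_mul_exp_neg (K : ℕ) {r : ℝ} (hr : 0 < r) :
    Tendsto (fun m : ℕ => ((m : ℝ) + 1) ^ K * Real.exp (-(m * r))) atTop (𝓝 0) := by
  have h1 : Tendsto (fun m : ℕ => ((m : ℝ) + 1) * r) atTop atTop :=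
    (tendsto_atTop_add_const_right _ 1 tendsto_natCast_atTop_atTop).atTop_mul_const hr
  have h2 := ((Real.tendsto_pow_mul_exp_neg_atTop_nhds_zero K).comp h1).const_mul
    (Real.exp r / r ^ K)
  rw [mul_zero] at h2
  refine h2.congr fun m => ?_
  have : Real.exp (-(m * r)) = Real.exp r * Real.exp (-(((m : ℝ) + 1) * r)) := by
    rw [← Real.exp_add]; congr 1; ring
  simp only [Function.comp, this, mul_pow]
  field_simp

/-- The weak law of large numbers for the empirical distribution. -/
theorem eventually_half_le_iidProb_empDist {Q : X → ℝ} (hQ : Q ∈ stdSimplex ℝ X)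
    (hQpos : ∀ x, 0 < Q x) {V : Set (X → ℝ)} (hV : IsOpen V) (hQV : Q ∈ V) :
    ∀ᶠ m : ℕ in atTop, 1 / 2 ≤ iidProb Q m {x | empDist x ∈ V} := by
  -- Off `V` the simplex is compact and the divergence from `Q` is positive, hence bounded away from
  -- 0.
  obtain ⟨r, hr, hmin⟩ := ((isCompact_stdSimplex ℝ X).diff hV).exists_forall_le'
    (continuous_relEntropy Q).continuousOn
    (fun T hT => relEntropy_pos hT.1 hQ hQpos fun h => hT.2 (h ▸ hQV))
  filter_upwards [(tendsto_succ_pow_mul_exp_neg (Fintype.card X) hr).eventually_le_const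
    (show (0 : ℝ) < 1 / 2 by norm_num), eventually_gt_atTop 0] with m hm hm0
  have h := iidProb_le_of_le_relEntropy hQpos hm0 (S := {x | empDist x ∈ V}ᶜ) (r := r)
    fun x hx => hmin _ ⟨empDist_mem_stdSimplex hm0 x, hx⟩
  have := iidProb_add_compl hQ m {x | empDist x ∈ V}
  linarith

/-- The large deviations lower bound for the empirical mean. -/
theorem eventually_exp_lt_iidProb {k : ℕ} (f : X → Fin k → ℝ) {Q W : X → ℝ}
    (hQ : Q ∈ stdSimplex ℝ X) (hQpos : ∀ x, 0 < Q x) (hW : ∀ x, 0 < W x)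
    {U : Set (Fin k → ℝ)} (hU : IsOpen U) (hQU : mean Q f ∈ U) {r c : ℝ}
    (hr : relEntropy Q W < r) (hc : 0 < c) :
    ∀ᶠ m : ℕ in atTop, Real.exp (-(m * r)) < c * iidProb W m {x | empMean f x ∈ U} := by
  obtain ⟨s, hs, hsr⟩ := exists_between hr
  -- The second condition is linear in `T`: it controls the exponent of the likelihood ratio of `Q`
  -- to `W`, and at `T = Q` its left side is `relEntropy Q W`.
  set V : Set (X → ℝ) := {T | mean T f ∈ U} ∩
    {T | ∑ a, T a * (Real.log (Q a) - Real.log (W a)) < s} with hVdef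
  have hV : IsOpen V := (hU.preimage (continuous_mean f)).inter
    (isOpen_lt (by fun_prop) continuous_const)
  have hlim := (tendsto_succ_pow_mul_exp_neg 0 (sub_pos.2 hsr)).eventually_lt_const
    (show (0 : ℝ) < c * (1 / 2) by positivity)
  filter_upwards [eventually_half_le_iidProb_empDist hQ hQpos hV ⟨hQU, hs⟩, hlim,
    eventually_gt_atTop 0] with m hm hm1 hm0
  have hle : Real.exp (-(m * s)) * iidProb Q m {x | empDist x ∈ V}
      ≤ iidProb W m {x | empMean f x ∈ U} := by
    rw [iidProb, iidProb, Finset.mul_sum]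
    refine Finset.sum_le_sum fun x _ => ?_
    by_cases hx : empDist x ∈ V
    · have hx' : empMean f x ∈ U := by rw [← mean_empDist]; exact hx.1
      rw [Set.indicator_of_mem (show x ∈ {x | empDist x ∈ V} from hx),
        Set.indicator_of_mem (show x ∈ {x | empMean f x ∈ U} from hx'),
        prod_eq_exp_mul_prod hm0 x (fun i => hQpos (x i)) fun i => hW (x i)]
      refine mul_le_mul_of_nonneg_right (Real.exp_le_exp.2 (neg_le_neg ?_))
        (Finset.prod_nonneg fun i _ => (hQpos _).le)
      exact mul_le_mul_of_nonneg_left hx.2.le (Nat.cast_nonneg m)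
    · rw [Set.indicator_of_notMem (show x ∉ {x | empDist x ∈ V} from hx), mul_zero]
      exact Set.indicator_nonneg (fun _ _ => Finset.prod_nonneg fun _ _ => (hW _).le) _
  rw [pow_zero, one_mul] at hm1
  calc Real.exp (-(m * r)) = Real.exp (-(m * s)) * Real.exp (-(m * (r - s))) := by
        rw [← Real.exp_add]; congr 1; ring
    _ < Real.exp (-(m * s)) * (c * (1 / 2)) := mul_lt_mul_of_pos_left hm1 (Real.exp_pos _)
    _ = c * (Real.exp (-(m * s)) * (1 / 2)) := by ring
    _ ≤ c * (Real.exp (-(m * s)) * iidProb Q m {x | empDist x ∈ V}) :=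
        mul_le_mul_of_nonneg_left (mul_le_mul_of_nonneg_left hm (Real.exp_pos _).le) hc.le
    _ ≤ _ := mul_le_mul_of_nonneg_left hle hc.le

/-! ### Shifting the mean of a normalized feature -/

theorem mean_add {k : ℕ} (P Q : X → ℝ) (f : X → Fin k → ℝ) :
    mean (P + Q) f = mean P f + mean Q f := by
  simp [mean, add_smul, Finset.sum_add_distrib]

theorem mean_smul {k : ℕ} (t : ℝ) (P : X → ℝ) (f : X → Fin k → ℝ) :
    mean (t • P) f = t • mean P f := by
  simp [mean, mul_smul, Finset.smul_sum]

theorem sum_mul_dotProduct {k : ℕ} (P : X → ℝ) (f : X → Fin k → ℝ) (v : Fin k → ℝ) :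
    ∑ x, P x * (f x ⬝ᵥ v) = mean P f ⬝ᵥ v := by
  simp [mean, sum_dotProduct, smul_dotProduct]

/-- The signed density `x ↦ p x * ⟨f x, v⟩`, which shifts the mean of a normalized feature
by `v`. -/
noncomputable def shift {k : ℕ} (p : X → ℝ) (f : X → Fin k → ℝ) (v : Fin k → ℝ) : X → ℝ :=
  fun x => p x * (f x ⬝ᵥ v)

theorem sum_shift {k : ℕ} {p : X → ℝ} {f : X → Fin k → ℝ} (hmean : mean p f = 0)
    (v : Fin k → ℝ) : ∑ x, shift p f v x = 0 := by
  simp [shift, sum_mul_dotProduct, hmean]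

theorem mean_shift {k : ℕ} {p : X → ℝ} {f : X → Fin k → ℝ} (hsec : secondMoment p f = 1)
    (v : Fin k → ℝ) : mean (shift p f v) f = v := by
  have h : mean (shift p f v) f = Matrix.mulVec (secondMoment p f) v := by
    simp only [mean, shift, secondMoment, Matrix.sum_mulVec, Matrix.smul_mulVec,
      Matrix.vecMulVec_mulVec, mul_smul]
    simp
  rw [h, hsec, Matrix.one_mulVec]

theorem sum_mul_dotProduct_sq {k : ℕ} {p : X → ℝ} {f : X → Fin k → ℝ}
    (hsec : secondMoment p f = 1) (v : Fin k → ℝ) : ∑ x, p x * (f x ⬝ᵥ v) ^ 2 = v ⬝ᵥ v := by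
  have h := sum_mul_dotProduct (shift p f v) f v
  rw [mean_shift hsec] at h
  rw [← h]
  exact Finset.sum_congr rfl fun x _ => by simp only [shift]; ring

/-! ### The error exponent as a constrained divergence infimum -/

/-- The values of `max (D(Q₀ ‖ W 0)) (D(Q₁ ‖ W 1))` over the pairs of distributions which give the
feature the same mean. -/
def exponentSet {k : ℕ} (W : Fin 2 → X → ℝ) (f : X → Fin k → ℝ) : Set ℝ :=
  {d | ∃ Q₀ ∈ stdSimplex ℝ X, ∃ Q₁ ∈ stdSimplex ℝ X, mean Q₀ f = mean Q₁ f ∧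
    d = max (relEntropy Q₀ (W 0)) (relEntropy Q₁ (W 1))}

theorem bddBelow_exponentSet {k : ℕ} {W : Fin 2 → X → ℝ} (hW : ∀ y, W y ∈ stdSimplex ℝ X)
    (hWpos : ∀ y x, 0 < W y x) (f : X → Fin k → ℝ) : BddBelow (exponentSet W f) := by
  refine ⟨0, ?_⟩
  rintro d ⟨Q₀, h₀, Q₁, -, -, rfl⟩
  exact le_max_of_le_left (relEntropy_nonneg h₀ (hW 0) (hWpos 0))

theorem exponentSet_nonempty {k : ℕ} {W : Fin 2 → X → ℝ} (hW : ∀ y, W y ∈ stdSimplex ℝ X)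
    (f : X → Fin k → ℝ) : (exponentSet W f).Nonempty :=
  ⟨_, W 0, hW 0, W 0, hW 0, rfl, rfl⟩

/-- A class-0 error forces a type at divergence more than `s` from `W 0`. A class-1 error gives a
type sharing its mean with some `Q` in the ball `D(Q ‖ W 0) ≤ s`; as `s` is below the infimum, that
type is at divergence more than `s` from `W 1`. The region is closed as the continuous image of a
compact set. -/
theorem exists_test_of_lt_sInf {k : ℕ} {pY : Fin 2 → ℝ} (hpY : pY ∈ stdSimplex ℝ (Fin 2))
    {W : Fin 2 → X → ℝ} (hW : ∀ y, W y ∈ stdSimplex ℝ X) (hWpos : ∀ y x, 0 < W y x)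
    (f : X → Fin k → ℝ) {r : ℝ} (hr : r < sInf (exponentSet W f)) :
    ∃ A : Set (Fin k → ℝ), IsClosed A ∧
      ∀ᶠ m : ℕ in atTop, bayesError pY W f A m ≤ Real.exp (-(m * r)) := by
  obtain ⟨s, hrs, hs⟩ := exists_between hr
  refine ⟨(fun Q => mean Q f) '' (stdSimplex ℝ X ∩ {Q | relEntropy Q (W 0) ≤ s}), ?_, ?_⟩
  · exact (((isCompact_stdSimplex ℝ X).inter_right
      (isClosed_le (continuous_relEntropy _) continuous_const)).image (continuous_mean f)).isClosed
  have hlim := (tendsto_succ_pow_mul_exp_neg (Fintype.card X) (sub_pos.2 hrs)).eventually_le_const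
    one_pos
  filter_upwards [hlim, eventually_gt_atTop 0] with m hm hm0
  set B := ((m : ℝ) + 1) ^ Fintype.card X * Real.exp (-(m * s)) with hB
  set A := (fun Q => mean Q f) '' (stdSimplex ℝ X ∩ {Q | relEntropy Q (W 0) ≤ s}) with hA
  have h0 : iidProb (W 0) m {x | empMean f x ∉ A} ≤ B := by
    refine iidProb_le_of_le_relEntropy (hWpos 0) hm0 fun x hx => ?_
    by_contra! hlt
    exact hx ⟨empDist x, ⟨empDist_mem_stdSimplex hm0 x, hlt.le⟩, mean_empDist f x⟩
  have h1 : iidProb (W 1) m {x | empMean f x ∈ A} ≤ B := by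
    refine iidProb_le_of_le_relEntropy (hWpos 1) hm0 fun x hx => ?_
    obtain ⟨Q, ⟨hQ, hQs⟩, hQm⟩ := hx
    have hmem : max (relEntropy Q (W 0)) (relEntropy (empDist x) (W 1)) ∈ exponentSet W f :=
      ⟨Q, hQ, empDist x, empDist_mem_stdSimplex hm0 x, hQm.trans (mean_empDist f x).symm, rfl⟩
    have := hs.trans_le (csInf_le (bddBelow_exponentSet hW hWpos f) hmem)
    rcases lt_max_iff.1 this with h | h
    · exact absurd h (not_lt.2 hQs)
    · exact h.le
  have hsum : pY 0 + pY 1 = 1 := by simpa [Fin.sum_univ_two] using hpY.2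
  calc bayesError pY W f A m ≤ pY 0 * B + pY 1 * B :=
        add_le_add (mul_le_mul_of_nonneg_left h0 (hpY.1 0)) (mul_le_mul_of_nonneg_left h1 (hpY.1 1))
    _ = (((m : ℝ) + 1) ^ Fintype.card X * Real.exp (-(m * (s - r)))) * Real.exp (-(m * r)) := by
        rw [← add_mul, hsum, one_mul, hB, mul_assoc, ← Real.exp_add]
        congr 2; ring
    _ ≤ 1 * Real.exp (-(m * r)) := mul_le_mul_of_nonneg_right hm (Real.exp_pos _).le
    _ = _ := one_mul _

/-- Mixing a near-optimal pair with a little of `p` restores full support and keeps the two means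
equal. Continuity of the divergence up to the boundary keeps it below `r`. -/
theorem exists_pos_pair_of_sInf_lt {k : ℕ} {W : Fin 2 → X → ℝ} (hW : ∀ y, W y ∈ stdSimplex ℝ X)
    {p : X → ℝ} (hp : p ∈ stdSimplex ℝ X) (hppos : ∀ x, 0 < p x)
    (f : X → Fin k → ℝ) {r : ℝ} (hr : sInf (exponentSet W f) < r) :
    ∃ Q : Fin 2 → X → ℝ, (∀ y, Q y ∈ stdSimplex ℝ X) ∧ (∀ y x, 0 < Q y x) ∧
      mean (Q 0) f = mean (Q 1) f ∧ ∀ y, relEntropy (Q y) (W y) < r := by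
  obtain ⟨d, ⟨Q₀, hQ₀, Q₁, hQ₁, hmean, rfl⟩, hd⟩ :=
    exists_lt_of_csInf_lt (exponentSet_nonempty hW f) hr
  obtain ⟨hd0, hd1⟩ := max_lt_iff.1 hd
  have hcont : ∀ (Q V : X → ℝ), relEntropy Q V < r →
      ∀ᶠ t : ℝ in 𝓝 0, relEntropy ((1 - t) • Q + t • p) V < r := by
    intro Q V h
    have hc : Continuous fun t : ℝ => relEntropy ((1 - t) • Q + t • p) V :=
      (continuous_relEntropy V).comp (by fun_prop)
    exact (hc.tendsto 0).eventually_lt_const (by simpa using h)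
  have hev : ∀ᶠ t : ℝ in 𝓝[>] 0, (relEntropy ((1 - t) • Q₀ + t • p) (W 0) < r ∧
      relEntropy ((1 - t) • Q₁ + t • p) (W 1) < r) ∧ t ∈ Set.Ioo (0 : ℝ) 1 :=
    (((hcont Q₀ _ hd0).and (hcont Q₁ _ hd1)).filter_mono nhdsWithin_le_nhds).and
      (Ioo_mem_nhdsGT one_pos)
  obtain ⟨t, ⟨ht0, ht1⟩, ht⟩ := hev.exists
  have hmix : ∀ Q ∈ stdSimplex ℝ X, (1 - t) • Q + t • p ∈ stdSimplex ℝ X ∧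
      ∀ x, 0 < ((1 - t) • Q + t • p) x := fun Q hQ =>
    ⟨convex_stdSimplex ℝ X hQ hp (by linarith [ht.2]) ht.1.le (by ring), fun x =>
      add_pos_of_nonneg_of_pos (mul_nonneg (by linarith [ht.2]) (hQ.1 x))
        (mul_pos ht.1 (hppos x))⟩
  refine ⟨![(1 - t) • Q₀ + t • p, (1 - t) • Q₁ + t • p], ?_, ?_, ?_, ?_⟩
  · intro y; fin_cases y
    exacts [(hmix _ hQ₀).1, (hmix _ hQ₁).1]
  · intro y; fin_cases y
    exacts [(hmix _ hQ₀).2, (hmix _ hQ₁).2]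
  · simp [mean_add, mean_smul, hmean]
  · intro y; fin_cases y
    exacts [ht0, ht1]

/-- The common mean of a near-optimal pair is either interior to `A`, which makes class 1 err, or a
limit of points of the open set `Aᶜ`, which makes class 0 err after a small perturbation of `Q 0`.
-/
theorem eventually_exp_lt_bayesError {k : ℕ} {pY : Fin 2 → ℝ} (hpos : ∀ y, 0 < pY y)
    {W : Fin 2 → X → ℝ} (hW : ∀ y, W y ∈ stdSimplex ℝ X) (hWpos : ∀ y x, 0 < W y x)
    {p : X → ℝ} (hp : p ∈ stdSimplex ℝ X) (hppos : ∀ x, 0 < p x) {f : X → Fin k → ℝ}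
    (hmean : mean p f = 0) (hsec : secondMoment p f = 1) {r : ℝ}
    (hr : sInf (exponentSet W f) < r) {A : Set (Fin k → ℝ)} (hA : IsClosed A) :
    ∀ᶠ m : ℕ in atTop, Real.exp (-(m * r)) < bayesError pY W f A m := by
  obtain ⟨Q, hQ, hQpos, hQm, hQr⟩ := exists_pos_pair_of_sInf_lt hW hp hppos f hr
  have hnn : ∀ y m S, 0 ≤ pY y * iidProb (W y) m S := fun y m S =>
    mul_nonneg (hpos y).le (iidProb_nonneg (fun x => (hWpos y x).le) m S)
  by_cases hint : mean (Q 1) f ∈ interior A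
  · filter_upwards [eventually_exp_lt_iidProb f (hQ 1) (hQpos 1) (hWpos 1) isOpen_interior hint
      (hQr 1) (hpos 1)] with m hm
    have hsub : {x : Fin m → X | empMean f x ∈ interior A} ⊆ {x | empMean f x ∈ A} :=
      fun x hx => interior_subset (s := A) hx
    exact hm.trans_le ((mul_le_mul_of_nonneg_left (iidProb_mono (fun x => (hWpos 1 x).le) hsub)
      (hpos 1).le).trans (le_add_of_nonneg_left (hnn 0 m _)))
  · have hcl : mean (Q 0) f ∈ closure Aᶜ := by
      rw [closure_compl, hQm]; exact hint
    -- A continuous family through `Q 0` whose member `R l` has feature mean `l`, so a mean inside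
    -- `Aᶜ` can be reached while the divergence stays below `r`.
    set R : (Fin k → ℝ) → X → ℝ := fun l => Q 0 + shift p f (l - mean (Q 0) f) with hR
    have hRc : Continuous R := by
      refine continuous_pi fun x => ?_
      simp only [hR, shift, Pi.add_apply, dotProduct]
      fun_prop
    have hR0 : R (mean (Q 0) f) = Q 0 := by
      funext x; simp [hR, shift]
    have hopen : IsOpen ({T : X → ℝ | relEntropy T (W 0) < r} ∩ {T | ∀ x, 0 < T x}) := by
      refine (isOpen_lt (continuous_relEntropy _) continuous_const).inter ?_
      rw [Set.ofPred_forall]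
      exact isOpen_iInter_of_finite fun x => isOpen_lt continuous_const (continuous_apply x)
    have hmem : R (mean (Q 0) f) ∈
        {T : X → ℝ | relEntropy T (W 0) < r} ∩ {T | ∀ x, 0 < T x} := by
      rw [hR0]; exact ⟨hQr 0, hQpos 0⟩
    obtain ⟨l, ⟨hl1, hl2⟩, hlA⟩ := mem_closure_iff.1 hcl _ (hopen.preimage hRc) hmem
    have hRs : R l ∈ stdSimplex ℝ X := by
      refine ⟨fun x => (hl2 x).le, ?_⟩
      simp only [hR, Pi.add_apply, Finset.sum_add_distrib, sum_shift hmean, (hQ 0).2, add_zero]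
    have hRm : mean (R l) f = l := by
      simp [hR, mean_add, mean_shift hsec]
    filter_upwards [eventually_exp_lt_iidProb f hRs hl2 (hWpos 0) hA.isOpen_compl
      (by rw [hRm]; exact hlA) hl1 (hpos 0)] with m hm
    exact hm.trans_le (le_add_of_nonneg_right (hnn 1 m _))

/-- The error exponent of the tests based on the empirical mean of a normalized feature. -/
theorem isErrorExponent_sInf {k : ℕ} {pY : Fin 2 → ℝ} (hpY : pY ∈ stdSimplex ℝ (Fin 2))
    (hpos : ∀ y, 0 < pY y) {W : Fin 2 → X → ℝ} (hW : ∀ y, W y ∈ stdSimplex ℝ X)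
    (hWpos : ∀ y x, 0 < W y x) {p : X → ℝ} (hp : p ∈ stdSimplex ℝ X) (hppos : ∀ x, 0 < p x)
    {f : X → Fin k → ℝ} (hmean : mean p f = 0) (hsec : secondMoment p f = 1) :
    IsErrorExponent pY W f (sInf (exponentSet W f)) :=
  ⟨fun _ hr => exists_test_of_lt_sInf hpY hW hWpos f hr,
    fun _ hr _ hA => eventually_exp_lt_bayesError hpos hW hWpos hp hppos hmean hsec hr hA⟩

/-! ### Second-order estimates of the divergence -/

theorem exp_le_one_add_add_sq {κ g : ℝ} (hκ : κ ≤ 1) (hg : |g| ≤ κ) :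
    Real.exp g ≤ 1 + g + (1 + κ) / 2 * g ^ 2 := by
  have h := Real.exp_bound (hg.trans hκ) (n := 3) (by norm_num)
  simp only [Finset.sum_range_succ, Finset.sum_range_zero, Nat.factorial] at h
  norm_num at h
  have h1 := (abs_le.1 h).2
  have h2 : |g| ^ 3 ≤ κ * g ^ 2 := by
    rw [← sq_abs g, pow_succ', pow_two]
    exact mul_le_mul_of_nonneg_right hg (by positivity)
  have h3 : 0 ≤ |g| ^ 3 := by positivity
  linarith

theorem one_add_mul_log_one_add_le {κ h : ℝ} (hκ : κ ≤ 1) (hh : |h| ≤ κ / 7) :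
    (1 + h) * Real.log (1 + h) ≤ h + (1 + κ) / 2 * h ^ 2 := by
  have hlt : |(-h)| < 1 := by rw [abs_neg]; linarith
  have hb := Real.abs_log_sub_add_sum_range_le hlt 2
  simp only [Finset.sum_range_succ, Finset.sum_range_zero, abs_neg] at hb
  norm_num at hb
  have h1 := (abs_le.1 hb).2
  have h2 : |h| ^ 3 / (1 - |h|) ≤ 2 * |h| ^ 3 := by
    rw [div_le_iff₀ (by linarith)]
    nlinarith [pow_nonneg (abs_nonneg h) 3]
  have h3 : |h| ^ 3 ≤ κ / 7 * h ^ 2 := by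
    rw [← sq_abs h, pow_succ', pow_two]
    exact mul_le_mul_of_nonneg_right hh (by positivity)
  obtain ⟨hl, hu⟩ := abs_le.1 (hh.trans (show κ / 7 ≤ 1 / 7 by linarith))
  have hlog : Real.log (1 + h) ≤ h - h ^ 2 / 2 + 2 * |h| ^ 3 := by linarith
  have hcube : -h ^ 3 ≤ |h| ^ 3 := by
    rw [← abs_pow]; exact neg_le_abs _
  have hcub0 : 0 ≤ |h| ^ 3 := by positivity
  calc (1 + h) * Real.log (1 + h) ≤ (1 + h) * (h - h ^ 2 / 2 + 2 * |h| ^ 3) :=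
        mul_le_mul_of_nonneg_left hlog (by linarith)
    _ = h + h ^ 2 / 2 + (-h ^ 3) / 2 + 2 * |h| ^ 3 * (1 + h) := by ring
    -- Since `1 + h ≤ 8 / 7`, the cubic terms total at most `(1/2 + 16/7) |h|³`; the bound `|h| ≤ κ
    -- / 7` then turns `7/2 |h|³` into `κ/2 h²`.
    _ ≤ h + h ^ 2 / 2 + 7 / 2 * |h| ^ 3 := by nlinarith
    _ ≤ h + (1 + κ) / 2 * h ^ 2 := by linarith

/-- The first-order terms of the expansion cancel because `s` has total mass zero. -/
theorem relEntropy_add_le {κ : ℝ} (hκ : κ ≤ 1) {W s : X → ℝ} (hW : ∀ x, 0 < W x)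
    (hs : ∀ x, |s x| ≤ κ / 7 * W x) (hsum : ∑ x, s x = 0) :
    relEntropy (W + s) W ≤ (1 + κ) / 2 * ∑ x, s x ^ 2 / W x := by
  have key : relEntropy (W + s) W ≤ ∑ x, (s x + (1 + κ) / 2 * (s x ^ 2 / W x)) := by
    refine Finset.sum_le_sum fun x _ => ?_
    have hw := hW x
    have hh : |s x / W x| ≤ κ / 7 := by
      rw [abs_div, abs_of_pos hw, div_le_iff₀ hw]; exact hs x
    have h1 : 0 < 1 + s x / W x := by linarith [(abs_le.1 hh).1]
    have hfac : (W + s) x = W x * (1 + s x / W x) := by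
      simp only [Pi.add_apply]; field_simp
    rw [hfac, Real.log_mul hw.ne' h1.ne', add_sub_cancel_left, mul_assoc]
    refine (mul_le_mul_of_nonneg_left (one_add_mul_log_one_add_le hκ hh) hw.le).trans_eq ?_
    field_simp
  rwa [Finset.sum_add_distrib, hsum, zero_add, ← Finset.mul_sum] at key

theorem relEntropy_add_shift_le {κ : ℝ} (hκ0 : 0 ≤ κ) (hκ : κ ≤ 1) {k : ℕ} {W p : X → ℝ}
    (hW : W ∈ stdSimplex ℝ X) (hWpos : ∀ x, 0 < W x) (hppos : ∀ x, 0 < p x)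
    (hpW : ∀ x, p x ≤ (1 + κ) * W x) {f : X → Fin k → ℝ} (hmean : mean p f = 0)
    (hsec : secondMoment p f = 1) {v : Fin k → ℝ} (hv : ∀ x, |f x ⬝ᵥ v| ≤ κ / 14) :
    W + shift p f v ∈ stdSimplex ℝ X ∧
      relEntropy (W + shift p f v) W ≤ (1 + κ) ^ 2 / 2 * (v ⬝ᵥ v) := by
  -- The bound `p ≤ (1 + κ) W ≤ 2 W` is why `κ / 14` is required of `⟨f x, v⟩`.
  have hs : ∀ x, |shift p f v x| ≤ κ / 7 * W x := by
    intro x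
    rw [shift, abs_mul, abs_of_pos (hppos x)]
    calc p x * |f x ⬝ᵥ v| ≤ ((1 + κ) * W x) * (κ / 14) :=
          mul_le_mul (hpW x) (hv x) (abs_nonneg _) (by have := hWpos x; positivity)
      _ ≤ (2 * W x) * (κ / 14) := by
          have := hWpos x
          gcongr
          linarith
      _ = κ / 7 * W x := by ring
  refine ⟨⟨fun x => ?_, ?_⟩, ?_⟩
  · have h1 := (abs_le.1 (hs x)).1
    have h2 : κ / 7 * W x ≤ 1 * W x := mul_le_mul_of_nonneg_right (by linarith) (hWpos x).le
    simp only [Pi.add_apply]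
    linarith
  · simp only [Pi.add_apply, Finset.sum_add_distrib, sum_shift hmean, hW.2, add_zero]
  · refine (relEntropy_add_le hκ hWpos hs (sum_shift hmean v)).trans ?_
    have : ∑ x, shift p f v x ^ 2 / W x ≤ (1 + κ) * (v ⬝ᵥ v) := by
      rw [← sum_mul_dotProduct_sq hsec v, Finset.mul_sum]
      refine Finset.sum_le_sum fun x _ => ?_
      rw [div_le_iff₀ (hWpos x), shift]
      have := mul_le_mul_of_nonneg_left (hpW x)
        (mul_nonneg (hppos x).le (sq_nonneg (f x ⬝ᵥ v)))
      linarith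
    calc (1 + κ) / 2 * ∑ x, shift p f v x ^ 2 / W x ≤ (1 + κ) / 2 * ((1 + κ) * (v ⬝ᵥ v)) :=
          mul_le_mul_of_nonneg_left this (by linarith)
      _ = _ := by ring

/-- The variational bound is tested on the linear function `⟨f, v⟩`. Replacing `W` by `p` in the
quadratic term makes it a multiple of `|v|²`. -/
theorem relEntropy_ge_dotProduct {κ : ℝ} (hκ0 : 0 ≤ κ) (hκ : κ ≤ 1) {k : ℕ} {Q W p : X → ℝ}
    (hQ : Q ∈ stdSimplex ℝ X) (hW : W ∈ stdSimplex ℝ X) (hWpos : ∀ x, 0 < W x)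
    (hWp : ∀ x, W x ≤ (1 + κ) * p x) {f : X → Fin k → ℝ} (hsec : secondMoment p f = 1)
    {v : Fin k → ℝ} (hv : ∀ x, |f x ⬝ᵥ v| ≤ κ / 14) :
    mean Q f ⬝ᵥ v - mean W f ⬝ᵥ v - (1 + κ) ^ 2 / 2 * (v ⬝ᵥ v) ≤ relEntropy Q W := by
  refine le_trans ?_ (relEntropy_ge hQ hWpos fun x => f x ⬝ᵥ v)
  have h : ∑ x, W x * Real.exp (f x ⬝ᵥ v) ≤
      ∑ x, (W x + W x * (f x ⬝ᵥ v) + (1 + κ) ^ 2 / 2 * (p x * (f x ⬝ᵥ v) ^ 2)) := by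
    refine Finset.sum_le_sum fun x _ => ?_
    have h1 := mul_le_mul_of_nonneg_left
      (exp_le_one_add_add_sq hκ ((hv x).trans (by linarith))) (hWpos x).le
    have h2 := mul_le_mul_of_nonneg_right (hWp x)
      (show 0 ≤ (1 + κ) / 2 * (f x ⬝ᵥ v) ^ 2 by positivity)
    linarith
  rw [Finset.sum_add_distrib, Finset.sum_add_distrib, ← Finset.mul_sum, hW.2,
    sum_mul_dotProduct, sum_mul_dotProduct_sq hsec] at h
  rw [sum_mul_dotProduct]
  linarith

/-- For the lower bound, test functions `v` and `-v` are used for the two classes: on adding, the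
common mean cancels, and the maximum is at least half the sum. For the upper bound, shifting the
classes by `v` and `-v` brings both means to their midpoint. -/
theorem abs_sInf_exponentSet_sub_le {κ : ℝ} (hκ0 : 0 ≤ κ) (hκ : κ ≤ 1) {k : ℕ}
    {W : Fin 2 → X → ℝ} {p : X → ℝ} (hW : ∀ y, W y ∈ stdSimplex ℝ X) (hWpos : ∀ y x, 0 < W y x)
    (hppos : ∀ x, 0 < p x) (hWp : ∀ y x, W y x ≤ (1 + κ) * p x)
    (hpW : ∀ y x, p x ≤ (1 + κ) * W y x) {f : X → Fin k → ℝ} (hmean : mean p f = 0)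
    (hsec : secondMoment p f = 1) {v : Fin k → ℝ}
    (hvdef : (2 : ℝ) • v = mean (W 1) f - mean (W 0) f) (hv : ∀ x, |f x ⬝ᵥ v| ≤ κ / 14) :
    |sInf (exponentSet W f) - (v ⬝ᵥ v) / 2| ≤ 3 / 2 * κ * (v ⬝ᵥ v) := by
  have hvv : 0 ≤ v ⬝ᵥ v := Finset.sum_nonneg fun i _ => mul_self_nonneg (v i)
  have hv' : ∀ x, |f x ⬝ᵥ (-v)| ≤ κ / 14 := fun x => by
    rw [dotProduct_neg, abs_neg]; exact hv x
  have hκsq : (1 + κ) ^ 2 * (v ⬝ᵥ v) ≤ (1 + 3 * κ) * (v ⬝ᵥ v) :=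
    mul_le_mul_of_nonneg_right (by nlinarith) hvv
  rw [abs_le]
  constructor
  · have hlow : (v ⬝ᵥ v) - (1 + κ) ^ 2 / 2 * (v ⬝ᵥ v) ≤ sInf (exponentSet W f) := by
      refine le_csInf (exponentSet_nonempty hW f) ?_
      rintro d ⟨Q₀, hQ₀, Q₁, hQ₁, hQm, rfl⟩
      have h0 := relEntropy_ge_dotProduct hκ0 hκ hQ₀ (hW 0) (hWpos 0) (hWp 0) hsec hv
      have h1 := relEntropy_ge_dotProduct hκ0 hκ hQ₁ (hW 1) (hWpos 1) (hWp 1) hsec hv'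
      simp only [dotProduct_neg, neg_dotProduct, neg_neg] at h1
      rw [hQm] at h0
      have h2 : 2 * (v ⬝ᵥ v) = mean (W 1) f ⬝ᵥ v - mean (W 0) f ⬝ᵥ v := by
        rw [← sub_dotProduct, ← hvdef, smul_dotProduct, smul_eq_mul]
      have h3 := le_max_left (relEntropy Q₀ (W 0)) (relEntropy Q₁ (W 1))
      have h4 := le_max_right (relEntropy Q₀ (W 0)) (relEntropy Q₁ (W 1))
      linarith
    linarith
  · obtain ⟨hs0, hd0⟩ := relEntropy_add_shift_le hκ0 hκ (hW 0) (hWpos 0) hppos (hpW 0) hmean hsec hv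
    obtain ⟨hs1, hd1⟩ :=
      relEntropy_add_shift_le hκ0 hκ (hW 1) (hWpos 1) hppos (hpW 1) hmean hsec hv'
    simp only [dotProduct_neg, neg_dotProduct, neg_neg] at hd1
    have hmem : max (relEntropy (W 0 + shift p f v) (W 0)) (relEntropy (W 1 + shift p f (-v)) (W 1))
        ∈ exponentSet W f := by
      refine ⟨_, hs0, _, hs1, ?_, rfl⟩
      rw [mean_add, mean_add, mean_shift hsec, mean_shift hsec, eq_add_neg_iff_add_eq, add_assoc,
        ← two_smul ℝ v, hvdef, add_sub_cancel]
    have := (csInf_le (bddBelow_exponentSet hW hWpos f) hmem).trans (max_le hd0 hd1)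
    linarith

/-! ### The H-score and chi-square neighborhoods -/

/-- Bessel's inequality: expand the nonnegative sum of `(w - 2 p ⟨f, v⟩)² / p`. -/
theorem four_mul_dotProduct_self_le {k : ℕ} {p w : X → ℝ} (hppos : ∀ x, 0 < p x)
    {f : X → Fin k → ℝ} (hsec : secondMoment p f = 1) {v : Fin k → ℝ}
    (hw : mean w f = (2 : ℝ) • v) : 4 * (v ⬝ᵥ v) ≤ ∑ x, w x ^ 2 / p x := by
  have h : 0 ≤ ∑ x, (w x ^ 2 / p x - 4 * (w x * (f x ⬝ᵥ v)) + 4 * (p x * (f x ⬝ᵥ v) ^ 2)) := by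
    refine Finset.sum_nonneg fun x _ => ?_
    have e : w x ^ 2 / p x - 4 * (w x * (f x ⬝ᵥ v)) + 4 * (p x * (f x ⬝ᵥ v) ^ 2)
        = (w x - 2 * p x * (f x ⬝ᵥ v)) ^ 2 / p x := by
      have := (hppos x).ne'
      field_simp
      ring
    rw [e]
    exact div_nonneg (sq_nonneg _) (hppos x).le
  rw [Finset.sum_add_distrib, Finset.sum_sub_distrib, ← Finset.mul_sum, ← Finset.mul_sum,
    sum_mul_dotProduct, sum_mul_dotProduct_sq hsec, hw, smul_dotProduct, smul_eq_mul] at h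
  linarith

theorem mean_marginal {k : ℕ} (pY : Fin 2 → ℝ) (W : Fin 2 → X → ℝ) (f : X → Fin k → ℝ) :
    mean (marginal pY W) f = pY 0 • mean (W 0) f + pY 1 • mean (W 1) f := by
  simp [mean, marginal, Fin.sum_univ_two, add_smul, mul_smul, Finset.smul_sum,
    Finset.sum_add_distrib]

/-- Centering forces the class means to be `-2 pY(1) v` and `2 pY(0) v`. -/
theorem hScore_eq {k : ℕ} {pY : Fin 2 → ℝ} (hpY : pY ∈ stdSimplex ℝ (Fin 2))
    {W : Fin 2 → X → ℝ} {f : X → Fin k → ℝ} (hmean : mean (marginal pY W) f = 0)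
    (hsec : secondMoment (marginal pY W) f = 1) {v : Fin k → ℝ}
    (hvdef : (2 : ℝ) • v = mean (W 1) f - mean (W 0) f) :
    hScore pY W f = 4 * (pY 0 * pY 1) * (v ⬝ᵥ v) := by
  have hsum : pY 0 + pY 1 = 1 := by simpa [Fin.sum_univ_two] using hpY.2
  have hm := hmean
  rw [mean_marginal] at hm
  have hc : mean pY (condMean W f) = 0 := by
    simpa [mean, condMean, Fin.sum_univ_two] using hm
  have h1 : cov (marginal pY W) f = 1 := by simp [cov, hmean, hsec]
  have hp1 : pY 1 = 1 - pY 0 := by linarith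
  have hμ0 : mean (W 0) f = (-(2 * pY 1)) • v := by
    funext i
    have a := congrFun hm i
    have b := congrFun hvdef i
    simp only [Pi.add_apply, Pi.smul_apply, Pi.sub_apply, Pi.zero_apply, smul_eq_mul] at a b ⊢
    rw [hp1] at a ⊢
    linear_combination a + (1 - pY 0) * b
  have hμ1 : mean (W 1) f = (2 * pY 0) • v := by
    funext i
    have a := congrFun hm i
    have b := congrFun hvdef i
    simp only [Pi.add_apply, Pi.smul_apply, Pi.sub_apply, Pi.zero_apply, smul_eq_mul] at a b ⊢
    rw [hp1] at a
    linear_combination a - pY 0 * b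
  rw [hScore, h1, inv_one, one_mul, cov, hc]
  simp only [sub_zero, secondMoment, Fin.sum_univ_two, Matrix.trace_add, Matrix.trace_smul,
    Matrix.trace_vecMulVec, condMean, hμ0, hμ1, smul_dotProduct, dotProduct_smul, smul_eq_mul]
  rw [hp1]; ring

theorem sq_sub_le_of_mem_chiSqBall {P₀ P : X → ℝ} (hpos : ∀ x, 0 < P₀ x) {ε : ℝ}
    (hP : P ∈ chiSqBall P₀ ε) (x : X) : (P x - P₀ x) ^ 2 ≤ ε ^ 2 * P₀ x := by
  rw [← div_le_iff₀ (hpos x)]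
  exact (Finset.single_le_sum (f := fun x => (P x - P₀ x) ^ 2 / P₀ x)
    (fun x _ => div_nonneg (sq_nonneg _) (hpos x).le) (Finset.mem_univ x)).trans hP.2

theorem abs_sub_le_of_mem_chiSqBall {P₀ P : X → ℝ} (hpos : ∀ x, 0 < P₀ x) {ε η q : ℝ}
    (hη : 0 ≤ η) (hq : ∀ x, q ≤ P₀ x) (hε : ε ^ 2 ≤ η ^ 2 * q)
    (hP : P ∈ chiSqBall P₀ ε) (x : X) : |P x - P₀ x| ≤ η * P₀ x := by
  refine abs_le_of_sq_le_sq ?_ (mul_nonneg hη (hpos x).le)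
  calc (P x - P₀ x) ^ 2 ≤ ε ^ 2 * P₀ x := sq_sub_le_of_mem_chiSqBall hpos hP x
    _ ≤ (η ^ 2 * P₀ x) * P₀ x := by
        have := hpos x
        have := hq x
        gcongr
        exact hε.trans (by gcongr)
    _ = (η * P₀ x) ^ 2 := by ring

theorem abs_marginal_sub_le {α : Type*} {pY : Fin 2 → ℝ} (hpY : pY ∈ stdSimplex ℝ (Fin 2))
    {W : Fin 2 → α → ℝ} {P₀ : α → ℝ} {η : ℝ} (hW : ∀ y x, |W y x - P₀ x| ≤ η * P₀ x) (x : α) :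
    |marginal pY W x - P₀ x| ≤ η * P₀ x := by
  have hsum : pY 0 + pY 1 = 1 := by simpa [Fin.sum_univ_two] using hpY.2
  have e : marginal pY W x - P₀ x = pY 0 * (W 0 x - P₀ x) + pY 1 * (W 1 x - P₀ x) := by
    simp only [marginal, Fin.sum_univ_two]
    linear_combination P₀ x * hsum
  rw [e]
  calc _ ≤ |pY 0 * (W 0 x - P₀ x)| + |pY 1 * (W 1 x - P₀ x)| := abs_add_le _ _
    _ = pY 0 * |W 0 x - P₀ x| + pY 1 * |W 1 x - P₀ x| := by
        rw [abs_mul, abs_mul, abs_of_nonneg (hpY.1 0), abs_of_nonneg (hpY.1 1)]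
    _ ≤ pY 0 * (η * P₀ x) + pY 1 * (η * P₀ x) :=
        add_le_add (mul_le_mul_of_nonneg_left (hW 0 x) (hpY.1 0))
          (mul_le_mul_of_nonneg_left (hW 1 x) (hpY.1 1))
    _ = η * P₀ x := by rw [← add_mul, hsum, one_mul]

theorem marginal_mem_stdSimplex {pY : Fin 2 → ℝ} (hpY : pY ∈ stdSimplex ℝ (Fin 2))
    {W : Fin 2 → X → ℝ} (hW : ∀ y, W y ∈ stdSimplex ℝ X) : marginal pY W ∈ stdSimplex ℝ X := by
  refine ⟨fun x => Finset.sum_nonneg fun y _ => mul_nonneg (hpY.1 y) ((hW y).1 x), ?_⟩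
  simp only [marginal]
  rw [Finset.sum_comm]
  simp only [← Finset.mul_sum, (hW _).2, mul_one, hpY.2]

theorem sum_sq_sub_div_le {P₀ p : X → ℝ} (hpos : ∀ x, 0 < P₀ x) {W : Fin 2 → X → ℝ} {ε : ℝ}
    (hW : ∀ y, W y ∈ chiSqBall P₀ ε) (hp : ∀ x, P₀ x ≤ 2 * p x) :
    ∑ x, (W 1 - W 0) x ^ 2 / p x ≤ 8 * ε ^ 2 := by
  calc ∑ x, (W 1 - W 0) x ^ 2 / p x
      ≤ ∑ x, (4 * ((W 1 x - P₀ x) ^ 2 / P₀ x) + 4 * ((W 0 x - P₀ x) ^ 2 / P₀ x)) := by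
        refine Finset.sum_le_sum fun x _ => ?_
        have h0 := hpos x
        have hpx : 0 < p x := by linarith [hp x]
        rw [← mul_add, ← add_div, ← mul_div_assoc, div_le_div_iff₀ hpx h0, Pi.sub_apply]
        have h1 : (W 1 x - W 0 x) ^ 2 ≤ 2 * ((W 1 x - P₀ x) ^ 2 + (W 0 x - P₀ x) ^ 2) := by
          nlinarith [sq_nonneg (W 1 x - P₀ x + (W 0 x - P₀ x))]
        calc (W 1 x - W 0 x) ^ 2 * P₀ x
            ≤ (2 * ((W 1 x - P₀ x) ^ 2 + (W 0 x - P₀ x) ^ 2)) * (2 * p x) :=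
              mul_le_mul h1 (hp x) h0.le (by positivity)
          _ = _ := by ring
    _ ≤ 8 * ε ^ 2 := by
        rw [Finset.sum_add_distrib, ← Finset.mul_sum, ← Finset.mul_sum]
        linarith [(hW 0).2, (hW 1).2]

end HScore

/-! ### Choice of constants and conclusion -/

theorem mainTheorem1 (pY : Fin 2 → ℝ) (hpY : pY ∈ stdSimplex ℝ (Fin 2)) (hpos : ∀ y, 0 < pY y) :
    ∃ c : ℝ, 0 < c ∧
      ∀ (X : Type*) [Fintype X] (P₀ : X → ℝ), P₀ ∈ stdSimplex ℝ X → (∀ x, 0 < P₀ x) →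
        ∀ δ : ℝ, 0 < δ → ∃ ε₀ : ℝ, 0 < ε₀ ∧ ∀ ε : ℝ, 0 < ε → ε < ε₀ →
          ∀ W : Fin 2 → X → ℝ, (∀ y, W y ∈ HScore.chiSqBall P₀ ε) →
            ∀ (k : ℕ) (f : X → Fin k → ℝ),
              HScore.mean (HScore.marginal pY W) f = 0 →
              HScore.secondMoment (HScore.marginal pY W) f = 1 →
              ∃ E : ℝ, HScore.IsErrorExponent pY W f E ∧
                |E - c * HScore.hScore pY W f| ≤ δ * ε ^ 2 := by
  have hp0 := hpos 0
  have hp1 := hpos 1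
  refine ⟨1 / (8 * (pY 0 * pY 1)), by positivity, ?_⟩
  intro X _ P₀ hP₀ hP₀pos δ hδ
  obtain ⟨q, hq0, hq⟩ : ∃ q : ℝ, 0 < q ∧ ∀ x, q ≤ P₀ x := by
    rcases isEmpty_or_nonempty X with h | h
    · exact ⟨1, one_pos, fun x => h.elim x⟩
    · obtain ⟨a, ha⟩ := Finite.exists_min P₀
      exact ⟨P₀ a, hP₀pos a, ha⟩
  -- The final error is `3/2 κ · 2ε² = 3κ ε²`.
  set κ : ℝ := min 1 (δ / 3) with hκdef
  have hκ0 : 0 < κ := lt_min one_pos (by positivity)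
  have hκ1 : κ ≤ 1 := min_le_left _ _
  have hκδ : 3 * κ ≤ δ := by linarith [min_le_right 1 (δ / 3)]
  -- Chosen so that `2ε² ≤ q/2 · (κ/14)²`, which bounds `⟨f x, v⟩` through `p x ≥ q / 2`.
  refine ⟨κ * √q / 28, by positivity, ?_⟩
  intro ε hε hεlt W hW k f hmean hsec
  have hε2 : ε ^ 2 ≤ (κ / 28) ^ 2 * q := by
    calc ε ^ 2 ≤ (κ * √q / 28) ^ 2 := pow_le_pow_left₀ hε.le hεlt.le 2
      _ = (κ / 28) ^ 2 * √q ^ 2 := by ring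
      _ = _ := by rw [Real.sq_sqrt hq0.le]
  have hε4 : ε ^ 2 ≤ (κ / 4) ^ 2 * q := hε2.trans (by gcongr; norm_num)
  have hWs : ∀ y, W y ∈ stdSimplex ℝ X := fun y => (hW y).1
  have hWP : ∀ y x, |W y x - P₀ x| ≤ κ / 4 * P₀ x := fun y =>
    HScore.abs_sub_le_of_mem_chiSqBall hP₀pos (by positivity) hq hε4 (hW y)
  have hpP := HScore.abs_marginal_sub_le hpY hWP
  set p := HScore.marginal pY W with hpdef
  have hbounds : ∀ {P : X → ℝ}, (∀ x, |P x - P₀ x| ≤ κ / 4 * P₀ x) →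
      ∀ x, (1 - κ / 4) * P₀ x ≤ P x ∧ P x ≤ (1 + κ / 4) * P₀ x := fun h x => by
    obtain ⟨h1, h2⟩ := abs_le.1 (h x)
    constructor <;> linarith
  have hpos' : ∀ {P : X → ℝ}, (∀ x, |P x - P₀ x| ≤ κ / 4 * P₀ x) →
      ∀ x, P₀ x ≤ 2 * P x := fun h x => by
    have h1 := (hbounds h x).1
    have h2 := hP₀pos x
    nlinarith
  have hcomp : ∀ {P R : X → ℝ}, (∀ x, |P x - P₀ x| ≤ κ / 4 * P₀ x) →
      (∀ x, |R x - P₀ x| ≤ κ / 4 * P₀ x) → ∀ x, P x ≤ (1 + κ) * R x := fun hP hR x => by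
    calc _ ≤ (1 + κ / 4) * P₀ x := (hbounds hP x).2
      _ ≤ ((1 + κ) * (1 - κ / 4)) * P₀ x :=
          mul_le_mul_of_nonneg_right (by nlinarith) (hP₀pos x).le
      _ = (1 + κ) * ((1 - κ / 4) * P₀ x) := by ring
      _ ≤ _ := mul_le_mul_of_nonneg_left (hbounds hR x).1 (by linarith)
  have hWpos : ∀ y x, 0 < W y x := fun y x => by linarith [hpos' (hWP y) x, hP₀pos x]
  have hppos : ∀ x, 0 < p x := fun x => by linarith [hpos' hpP x, hP₀pos x]
  set v : Fin k → ℝ := (2 : ℝ)⁻¹ • (HScore.mean (W 1) f - HScore.mean (W 0) f) with hv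
  have hvdef : (2 : ℝ) • v = HScore.mean (W 1) f - HScore.mean (W 0) f := by
    rw [hv, smul_inv_smul₀ two_ne_zero]
  have hw : HScore.mean (W 1 - W 0) f = (2 : ℝ) • v := by
    rw [hvdef, eq_sub_iff_add_eq, ← HScore.mean_add, sub_add_cancel]
  have hvv : v ⬝ᵥ v ≤ 2 * ε ^ 2 := by
    linarith [HScore.four_mul_dotProduct_self_le hppos hsec hw,
      HScore.sum_sq_sub_div_le hP₀pos hW (hpos' hpP)]
  have hfv : ∀ x, |f x ⬝ᵥ v| ≤ κ / 14 := by
    intro x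
    refine abs_le_of_sq_le_sq ?_ (by positivity)
    -- A single term of the second moment identity bounds `⟨f x, v⟩` pointwise, with no dependence
    -- on `k`.
    have h1 : p x * (f x ⬝ᵥ v) ^ 2 ≤ v ⬝ᵥ v := by
      rw [← HScore.sum_mul_dotProduct_sq hsec v]
      exact Finset.single_le_sum (f := fun x => p x * (f x ⬝ᵥ v) ^ 2)
        (fun x _ => mul_nonneg (hppos x).le (sq_nonneg _)) (Finset.mem_univ x)
    have h2 : q / 2 * (f x ⬝ᵥ v) ^ 2 ≤ p x * (f x ⬝ᵥ v) ^ 2 :=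
      mul_le_mul_of_nonneg_right (by linarith [hpos' hpP x, hq x]) (sq_nonneg _)
    have h3 : q / 2 * (f x ⬝ᵥ v) ^ 2 ≤ q / 2 * (κ / 14) ^ 2 := by linarith
    exact le_of_mul_le_mul_left h3 (by positivity)
  refine ⟨sInf (HScore.exponentSet W f), HScore.isErrorExponent_sInf hpY hpos hWs hWpos
    (HScore.marginal_mem_stdSimplex hpY hWs) hppos hmean hsec, ?_⟩
  rw [HScore.hScore_eq hpY hmean hsec hvdef]
  have e : 1 / (8 * (pY 0 * pY 1)) * (4 * (pY 0 * pY 1) * (v ⬝ᵥ v)) = (v ⬝ᵥ v) / 2 := by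
    field_simp
    ring
  rw [e]
  calc _ ≤ 3 / 2 * κ * (v ⬝ᵥ v) := HScore.abs_sInf_exponentSet_sub_le hκ0.le hκ1 hWs hWpos hppos
        (fun y => hcomp (hWP y) hpP) (fun y => hcomp hpP (hWP y)) hmean hsec hvdef hfv
    _ ≤ 3 / 2 * κ * (2 * ε ^ 2) := mul_le_mul_of_nonneg_left hvv (by positivity)
    _ = 3 * κ * ε ^ 2 := by ring
    _ ≤ δ * ε ^ 2 := mul_le_mul_of_nonneg_right hκδ (sq_nonneg _)
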